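/- Consider a server with a library of $N\ge 3$ files $W_1,\dots,W_N$ of $F$ bits each (all $NF$ bits independent and uniform) and $K=3$ users, where user $k$ has a cache of $m_kNF$ bits and $0\le m_1\le m_2\le m_3\le 1$. An \emph{uncoded placement} is given by an element $a$ of $$\mathfrak A(\boldsymbol m)=\Big\{a\in[0,1]^{2^{\{1,2,3\}}} : \sum_{S\subseteq\{1,2,3\}}a_S=1,\ \sum_{S\ni k}a_S\le m_k \text{ for } k=1,2,3\Big\}$$ together with a partition of each file $W_l$ into subfiles $\tilde W_{l,S}$, $S\subseteq\{1,2,3\}$, of $a_SF$ bits each; user $k$ caches exactly the subfiles $\tilde W_{l,S}$ with $k\in S$, before the demands are known. Given the demand vector $d=(d_1,d_2,d_3)\in\{1,\dots,N\}^3$, the server sends, for each non-empty $T\subseteq\{1,2,3\}$, a signal $X_{T,d}$ of $\lfloor v_{T,d}F\rfloor$ bits, $v_{T,d}\ge 0$, which is an arbitrary function of $(W_{d_1},W_{d_2},W_{d_3})$, and user $k$ forms an estimate $\hat W_{d_k}$ of $W_{d_k}$ as an arbitrary function of all the signals and of its cache content. The worst-case delivery load of the scheme is $\max_d\sum_{T}v_{T,d}$.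 A load $R$ is \emph{achievable with uncoded placement} if for every $\epsilon>0$ and all sufficiently large $F$ there are an uncoded placement given by some $a\in\mathfrak A(\boldsymbol m)$ and a delivery scheme of worst-case delivery load $R$ with $\max_{d,k}\Pr(\hat W_{d_k}\ne W_{d_k})\le\epsilon$. Let $R^*_{\mathfrak A}(\boldsymbol m)$ be the infimum of these loads. \textbf{Theorem.} The set of loads that are achievable with uncoded placement is non-empty and bounded below, and $$R^*_{\mathfrak A}(\boldsymbol m)=\max\Big\{3-\sum_{j=1}^3(4-j)m_j,\ \ \frac53-\sum_{j=1}^3\frac{(4-j)m_j}{3},\ \ 2-2m_1-m_2,\ \ 1-m_1\Big\}.$$ In particular: \begin{enumerate} \item If $m_1+m_2+m_3\le 1$, then $R^*_{\mathfrak A}(\boldsymbol m)=3-\sum_{j=1}^3(4-j)m_j$. \item If $1\le m_1+m_2+m_3\le 2$, then \begin{itemize} \item if $m_3<m_2+3m_1-1$ and $2m_2+m_3<2$, then $R^*_{\mathfrak A}(\boldsymbol m)=\frac53-\sum_{j=1}^3\frac{(4-j)m_j}{3}$; \item if $m_3\ge m_2+3m_1-1$ and $m_1+m_2<1$, then $R^*_{\mathfrak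 A}(\boldsymbol m)=2-2m_1-m_2$; \item if $2m_2+m_3\ge 2$ and $m_1+m_2\ge 1$, then $R^*_{\mathfrak A}(\boldsymbol m)=1-m_1$. \end{itemize} \item If $m_1+m_2+m_3\ge 2$, then $R^*_{\mathfrak A}(\boldsymbol m)=1-m_1$. \end{enumerate} -/

import Mathlib

namespace CodedCaching

/-- A file of `F` bits. -/
abbrev File (F : ℕ) : Type := Fin F → Bool

/-- A library of `N` files of `F` bits each. -/
abbrev Library (N F : ℕ) : Type := Fin N → File F

/-- A demand vector: user `k` requests file `d k`. -/
abbrev Demand (K N : ℕ) : Type := Fin K → Fin N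

/-- The non-empty sets of users, to which the server addresses its signals. -/
abbrev UserGroup (K : ℕ) : Type := {T : Finset (Fin K) // T.Nonempty}

/-- The set `𝔄(m)` of uncoded placements for the normalized cache sizes `m`: `a S` is the fraction
of each file that is stored exclusively at the users in `S`. -/
def uncodedAllocations {K : ℕ} (m : Fin K → ℝ) : Set (Finset (Fin K) → ℝ) :=
  {a | (∀ S, a S ∈ Set.Icc (0 : ℝ) 1) ∧ ∑ S, a S = 1 ∧
    ∀ k, ∑ S ∈ Finset.univ.filter (fun S : Finset (Fin K) => k ∈ S), a S ≤ m k}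

/-- An uncoded placement for `N` files of `F` bits. Bit `i` of file `l` is stored exactly at the
users in `storedAt l i`. The bits of file `l` with `storedAt l i = S` form the subfile of file `l`
with label `S`; it has `alloc S * F` bits, for every `l`. As `alloc ∈ 𝔄(m)`, user `k` caches at
most `m k * F` bits of each file. -/
structure UncodedPlacement {K : ℕ} (N F : ℕ) (m : Fin K → ℝ) where
  alloc : Finset (Fin K) → ℝ
  alloc_mem : alloc ∈ uncodedAllocations m
  storedAt : Fin N → Fin F → Finset (Fin K)
  card_subfile : ∀ (l : Fin N) (S : Finset (Fin K)),
    ((Finset.univ.filter (fun i : Fin F => storedAt l i = S)).card : ℝ) = alloc S * F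

namespace UncodedPlacement

variable {K N F : ℕ} {m : Fin K → ℝ}

/-- The positions (file, bit) that user `k` caches. -/
abbrev CachedBit (P : UncodedPlacement N F m) (k : Fin K) : Type :=
  {p : Fin N × Fin F // k ∈ P.storedAt p.1 p.2}

/-- The cache content `Z_k` of user `k` when the library is `W`. -/
def cacheContent (P : UncodedPlacement N F m) (k : Fin K) (W : Library N F) :
    P.CachedBit k → Bool :=
  fun p => W p.1.1 p.1.2

end UncodedPlacement

/-- A delivery scheme for a given uncoded placement, with arbitrary (not necessarily linear)
encoding and decoding functions. For demand `d`, the signal for the user group `T` has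
`⌊v d T * F⌋` bits and is a function of the requested files; every user sees all the signals and
its own cache content. -/
structure DeliveryScheme {K N F : ℕ} {m : Fin K → ℝ} (P : UncodedPlacement N F m) where
  v : Demand K N → UserGroup K → ℝ
  v_nonneg : ∀ d T, 0 ≤ v d T
  encode : ∀ (d : Demand K N) (T : UserGroup K),
    (Fin K → File F) → (Fin ⌊v d T * F⌋₊ → Bool)
  decode : ∀ (d : Demand K N) (k : Fin K),
    (∀ T : UserGroup K, Fin ⌊v d T * F⌋₊ → Bool) → (P.CachedBit k → Bool) → File F

namespace DeliveryScheme

variable {K N F : ℕ} {m : Fin K → ℝ} {P : UncodedPlacement N F m}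

/-- The delivery load for the demand `d`, in units of the file size. -/
def load (D : DeliveryScheme P) (d : Demand K N) : ℝ := ∑ T, D.v d T

/-- The worst-case delivery load, the maximum of the load over all demands. -/
noncomputable def worstCaseLoad (D : DeliveryScheme P) : ℝ := ⨆ d, D.load d

/-- The file that user `k` reconstructs for the demand `d` when the library is `W`. -/
def reconstruct (D : DeliveryScheme P) (d : Demand K N) (k : Fin K) (W : Library N F) : File F :=
  D.decode d k (fun T => D.encode d T (fun j => W (d j))) (P.cacheContent k W)

/-- The probability that user `k` fails to recover its requested file for the demand `d`, when the
library is uniformly distributed, that is, all its `N * F` bits are independent and fair. -/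
noncomputable def errorProb (D : DeliveryScheme P) (d : Demand K N) (k : Fin K) : ℝ :=
  ((Finset.univ.filter (fun W : Library N F => D.reconstruct d k W ≠ W (d k))).card : ℝ) /
    (Fintype.card (Library N F) : ℝ)

end DeliveryScheme

/-- The delivery loads achievable with uncoded placement: `R` is achievable if for every `ε > 0` and
all large enough file sizes `F` there are an uncoded placement in `𝔄(m)` and a delivery scheme of
worst-case load `R` with error probability at most `ε` for every demand and every user. -/
def achievableLoads {K : ℕ} (N : ℕ) (m : Fin K → ℝ) : Set ℝ :=
  {R | ∀ ε : ℝ, 0 < ε → ∃ F₀ : ℕ, ∀ F : ℕ, F₀ ≤ F →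
    ∃ (P : UncodedPlacement N F m) (D : DeliveryScheme P),
      D.worstCaseLoad = R ∧ ∀ (d : Demand K N) (k : Fin K), D.errorProb d k ≤ ε}

/-- The minimum worst-case delivery load `R*_𝔄(m)` with uncoded placement. -/
noncomputable def minUncodedLoad {K : ℕ} (N : ℕ) (m : Fin K → ℝ) : ℝ := sInf (achievableLoads N m)

end CodedCaching

/-!
The minimum load is bounded from both sides by counting arguments that are tight for three users.

*Lower bound.* Let the users have distinct demands and decode one after the other, in the order `σ`,
each making known its cache and its file. Leave out of the library, for every `i`, the bits of the
file requested by `σ i` that none of `σ 0, …, σ i` caches. When `σ i` decodes, the only bits left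
out that its cache contains belong to files decoded before. Hence the signals, together with the
bits not left out, determine every correctly decoded library (`eq_of_signals_eq`).
When at least half of the libraries are decoded correctly, comparing
cardinalities shows that the signals have at least as many bits as were left out, up to one
(`card_acyclicBits_le`); no Fano inequality is needed. This gives, for every `σ`, a linear lower
bound on the load in terms of the allocation `a`. For three users the order `012` yields three of
the four terms of the maximum by means of the cache constraints, and the average of the bounds for
`012`, `021` and `120` yields the fourth (`le_of_mem_achievableLoads`).

*Achievability.* A block of bit positions with cache labels is delivered by XORs each of which is
useful to every user that has a summand in it (`XorScheme`). Such schemes can be juxtaposed, and a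
bounded number of uncached bits can be added at bounded cost, so the pairs (cache sizes, load) that
they attain asymptotically form a convex set (`convex_xorRegion`). The claimed load is piecewise
linear in the cache sizes; its regions of linearity are polytopes with nine vertices altogether, at
each of which a scheme with at most three positions is optimal. Cutting the regions into seven
simplices expresses every point as a convex combination of four of these vertices
(`max_mem_xorRegion`). The bounded overhead is absorbed by any load above the maximum
(`mem_achievableLoads_of_mem_xorRegion`), which suffices for the infimum.
-/

namespace CodedCaching

open Finset

variable {K N F : ℕ}

/-! ### Counting bound for uncoded placement -/

/-- The bits of the requested files such that a bit of the file requested by user `σ i` is cached by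
none of `σ 0, …, σ i`. For distinct demands, when the users decode in the order `σ`, none of them
has in its cache such a bit of its own file or of a file decoded later. -/
def acyclicBits {m : Fin K → ℝ} (P : UncodedPlacement N F m) (d : Demand K N)
    (σ : Equiv.Perm (Fin K)) : Finset (Fin N × Fin F) :=
  univ.filter fun p => ∃ i, d (σ i) = p.1 ∧ ∀ j ≤ i, σ j ∉ P.storedAt p.1 p.2

/-- With distinct demands, the numbers of acyclic bits of the users add up. -/
lemma card_acyclicBits {m : Fin K → ℝ} (P : UncodedPlacement N F m) {d : Demand K N}
    (hd : Function.Injective d) (σ : Equiv.Perm (Fin K)) :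
    ((acyclicBits P d σ).card : ℝ) =
      (∑ i, ∑ S with ∀ j ≤ i, σ j ∉ S, P.alloc S) * F := by
  have hfib : ∀ i, ((univ.filter fun b : Fin F =>
      ∀ j ≤ i, σ j ∉ P.storedAt (d (σ i)) b).card : ℝ) =
      (∑ S with ∀ j ≤ i, σ j ∉ S, P.alloc S) * F := by
    intro i
    rw [card_eq_sum_card_fiberwise (f := P.storedAt (d (σ i)))
      (t := univ.filter fun S : Finset (Fin K) => ∀ j ≤ i, σ j ∉ S)
      (fun b hb => by simpa using hb), Nat.cast_sum, sum_mul]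
    refine sum_congr rfl fun S hS => ?_
    rw [← P.card_subfile (d (σ i)) S, filter_filter]
    congr 2
    ext b
    simp only [mem_filter, mem_univ, true_and] at hS ⊢
    exact ⟨fun h => h.2, fun h => ⟨by rw [h]; exact hS, h⟩⟩
  have hU : acyclicBits P d σ = univ.biUnion fun i : Fin K =>
      (univ.filter fun b : Fin F => ∀ j ≤ i, σ j ∉ P.storedAt (d (σ i)) b).image
        fun b => (d (σ i), b) := by
    ext ⟨l, b⟩
    simp only [acyclicBits, mem_filter, mem_univ, true_and, mem_biUnion, mem_image, Prod.mk.injEq]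
    constructor
    · rintro ⟨i, rfl, h⟩
      exact ⟨i, b, h, rfl, rfl⟩
    · rintro ⟨i, b', h, rfl, rfl⟩
      exact ⟨i, rfl, h⟩
  rw [hU, card_biUnion, Nat.cast_sum, sum_mul]
  · refine sum_congr rfl fun i _ => ?_
    rw [card_image_of_injective _ (fun b b' h => (Prod.mk.inj h).2), hfib]
  · intro i _ i' _ hne
    rw [Function.onFun, disjoint_left]
    intro p hp hp'
    simp only [mem_image] at hp hp'
    obtain ⟨b, -, rfl⟩ := hp
    obtain ⟨b', -, h⟩ := hp'
    exact hne (σ.injective (hd (Prod.mk.inj h).1)).symm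

/-- Successive decoding: the signals together with the bits outside `acyclicBits` determine every
library that all users decode correctly. User `σ 0` decodes from its own cache; user `σ i` knows
from its cache only bits outside `acyclicBits` and bits of files decoded before. -/
lemma eq_of_signals_eq {m : Fin K → ℝ} {P : UncodedPlacement N F m} (D : DeliveryScheme P)
    (d : Demand K N) (σ : Equiv.Perm (Fin K)) {W W' : Library N F}
    (hW : ∀ k, D.reconstruct d k W = W (d k)) (hW' : ∀ k, D.reconstruct d k W' = W' (d k))
    (hX : ∀ T, D.encode d T (fun j => W (d j)) = D.encode d T (fun j => W' (d j)))
    (hZ : ∀ p ∉ acyclicBits P d σ, W p.1 p.2 = W' p.1 p.2) : W = W' := by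
  have key : ∀ i, W (d (σ i)) = W' (d (σ i)) := by
    intro i
    induction i using WellFoundedLT.induction with
    | ind i ih =>
      have hcache : P.cacheContent (σ i) W = P.cacheContent (σ i) W' := by
        funext ⟨p, hp⟩
        by_cases hpU : p ∈ acyclicBits P d σ
        · simp only [acyclicBits, mem_filter, mem_univ, true_and] at hpU
          obtain ⟨i', hi', hS⟩ := hpU
          have hlt : i' < i := by
            by_contra hge
            exact hS i (not_lt.1 hge) hp
          have := ih i' hlt
          rw [hi'] at this
          exact congrFun this p.2
        · exact hZ p hpU
      rw [← hW (σ i), ← hW' (σ i), DeliveryScheme.reconstruct, DeliveryScheme.reconstruct,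
        hcache, funext hX]
  funext l b
  by_cases hpU : (l, b) ∈ acyclicBits P d σ
  · simp only [acyclicBits, mem_filter, mem_univ, true_and] at hpU
    obtain ⟨i, rfl, -⟩ := hpU
    rw [key i]
  · exact hZ (l, b) hpU

/-- If all users decode correctly with probability at least one half, the signals carry all the
bits in `acyclicBits`, up to one bit. -/
lemma card_acyclicBits_le {m : Fin K → ℝ} {P : UncodedPlacement N F m} (D : DeliveryScheme P)
    (d : Demand K N) (σ : Equiv.Perm (Fin K)) {ε : ℝ} (hε : K * ε ≤ 1 / 2)
    (herr : ∀ k, D.errorProb d k ≤ ε) :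
    (acyclicBits P d σ).card ≤ ∑ T, ⌊D.v d T * F⌋₊ + 1 := by
  classical
  set good : Finset (Library N F) := univ.filter fun W => ∀ k, D.reconstruct d k W = W (d k)
    with hgood
  set bad : Fin K → Finset (Library N F) := fun k =>
    univ.filter fun W => D.reconstruct d k W ≠ W (d k) with hbad
  have hcardpos : (0 : ℝ) < Fintype.card (Library N F) := by
    exact_mod_cast Fintype.card_pos
  have hbadcard : ∀ k, ((bad k).card : ℝ) ≤ ε * Fintype.card (Library N F) := fun k => by
    have := herr k
    rwa [DeliveryScheme.errorProb, div_le_iff₀ hcardpos] at this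
  have hcover : (univ : Finset (Library N F)) ⊆ good ∪ univ.biUnion bad := by
    intro W _
    simp only [hgood, hbad, mem_union, mem_filter, mem_univ, true_and, mem_biUnion]
    by_cases h : ∀ k, D.reconstruct d k W = W (d k)
    · exact Or.inl h
    · exact Or.inr (not_forall.1 h)
  have h1 : Fintype.card (Library N F) ≤ good.card + ∑ k, (bad k).card := by
    calc Fintype.card (Library N F) = (univ : Finset (Library N F)).card := rfl
      _ ≤ (good ∪ univ.biUnion bad).card := card_le_card hcover
      _ ≤ good.card + (univ.biUnion bad).card := card_union_le _ _
      _ ≤ _ := Nat.add_le_add_left card_biUnion_le _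
  -- By the union bound, all users decode at least half of the libraries correctly.
  have h2 : Fintype.card (Library N F) ≤ 2 * good.card := by
    have h3 : (Fintype.card (Library N F) : ℝ) ≤ good.card + ∑ k, ((bad k).card : ℝ) := by
      exact_mod_cast h1
    have h4 : ∑ k, ((bad k).card : ℝ) ≤ 1 / 2 * Fintype.card (Library N F) := by
      calc ∑ k, ((bad k).card : ℝ) ≤ ∑ _k : Fin K, ε * Fintype.card (Library N F) :=
            sum_le_sum fun k _ => hbadcard k
        _ = (K * ε) * Fintype.card (Library N F) := by simp [mul_assoc]
        _ ≤ _ := mul_le_mul_of_nonneg_right hε hcardpos.le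
    have h5 : (Fintype.card (Library N F) : ℝ) ≤ 2 * good.card := by linarith
    exact_mod_cast h5
  let φ : good → (∀ T : UserGroup K, Fin ⌊D.v d T * F⌋₊ → Bool) ×
      ({p // p ∉ acyclicBits P d σ} → Bool) := fun W =>
    (fun T => D.encode d T (fun j => W.1 (d j)), fun p => W.1 p.1.1 p.1.2)
  have hφ : Function.Injective φ := by
    rintro ⟨W, hW⟩ ⟨W', hW'⟩ h
    obtain ⟨hX, hZ⟩ := Prod.mk.inj h
    simp only [hgood, mem_filter, mem_univ, true_and] at hW hW'
    exact Subtype.ext (eq_of_signals_eq D d σ hW hW' (fun T => congrFun hX T)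
      fun p hp => congrFun hZ ⟨p, hp⟩)
  have h6 : good.card ≤ 2 ^ (∑ T, ⌊D.v d T * F⌋₊) * 2 ^ (N * F - (acyclicBits P d σ).card) := by
    have := Fintype.card_le_of_injective φ hφ
    simpa [Fintype.card_pi, Fintype.card_subtype_compl, prod_pow_eq_pow_sum] using this
  have h7 : Fintype.card (Library N F) = 2 ^ (N * F) := by
    simp [← pow_mul, mul_comm]
  have hle : (acyclicBits P d σ).card ≤ N * F := by
    simpa using card_le_univ (acyclicBits P d σ)
  have h8 : 2 ^ (N * F) ≤
      2 ^ (1 + ∑ T, ⌊D.v d T * F⌋₊ + (N * F - (acyclicBits P d σ).card)) := by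
    rw [← h7, pow_add, pow_add, pow_one, mul_assoc]
    exact h2.trans (Nat.mul_le_mul_left 2 h6)
  have h9 := (Nat.pow_le_pow_iff_right (by norm_num : 1 < 2)).1 h8
  omega

/-- The acyclic bound: a load achievable with uncoded placement is, up to an arbitrarily small
amount, at least the normalized number of acyclic bits of one placement, for every order of the
users. -/
lemma exists_alloc_le_of_mem_achievableLoads (hKN : K ≤ N) {m : Fin K → ℝ} {R : ℝ}
    (hR : R ∈ achievableLoads N m) {δ : ℝ} (hδ : 0 < δ) :
    ∃ a ∈ uncodedAllocations m, ∀ σ : Equiv.Perm (Fin K),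
      ∑ i, ∑ S with ∀ j ≤ i, σ j ∉ S, a S ≤ R + δ := by
  obtain ⟨F₀, hF₀⟩ := hR (1 / (2 * (K + 1))) (by positivity)
  obtain ⟨n, hn⟩ := exists_nat_gt (1 / δ)
  set F := max F₀ (max n 1) with hF
  obtain ⟨P, D, hload, herr⟩ := hF₀ F (le_max_left _ _)
  refine ⟨P.alloc, P.alloc_mem, fun σ => ?_⟩
  have hFpos : (0 : ℝ) < F := by
    have : 1 ≤ F := (le_max_right n 1).trans (le_max_right _ _)
    exact_mod_cast this
  have hδF : 1 ≤ δ * F := by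
    have : (n : ℝ) ≤ F := by exact_mod_cast (le_max_left n 1).trans (le_max_right _ _)
    rw [div_lt_iff₀ hδ] at hn
    nlinarith
  -- The bound is read off from a demand vector with distinct entries.
  set d : Demand K N := Fin.castLE hKN
  have h1 := card_acyclicBits_le D d σ (ε := 1 / (2 * (K + 1)))
    (by rw [mul_one_div, div_le_div_iff₀ (by positivity) (by norm_num)]; linarith) (herr d)
  have h2 : ((acyclicBits P d σ).card : ℝ) ≤ ∑ T, (⌊D.v d T * F⌋₊ : ℝ) + 1 := by
    exact_mod_cast h1
  have h3 : ∑ T, (⌊D.v d T * F⌋₊ : ℝ) ≤ D.load d * F := by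
    rw [DeliveryScheme.load, sum_mul]
    exact sum_le_sum fun T _ => Nat.floor_le (mul_nonneg (D.v_nonneg d T) hFpos.le)
  have h4 : D.load d ≤ R := by
    rw [← hload]
    exact le_ciSup (Set.finite_range D.load).bddAbove d
  rw [card_acyclicBits P (Fin.castLE_injective hKN) σ] at h2
  have h5 : (∑ i, ∑ S with ∀ j ≤ i, σ j ∉ S, P.alloc S) * F ≤ (R + δ) * F := by
    nlinarith [mul_le_mul_of_nonneg_right h4 hFpos.le]
  exact le_of_mul_le_mul_right h5 hFpos

/-! ### XOR delivery -/

/-- A linear delivery scheme for a block of bit positions `ι`, used alike for every file: position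
`i` is cached by the users in `label i`, and transmission `j` is the XOR, over the users `k`, of the
bit at position `summand j k` of the file requested by `k` (nothing if `none`). Each bit that user
`k` misses occurs in some transmission all of whose other summands `k` has cached. -/
structure XorScheme (K : ℕ) (ι J : Type) where
  label : ι → Finset (Fin K)
  summand : J → Fin K → Option ι
  decodable : ∀ k i, k ∉ label i →
    ∃ j, summand j k = some i ∧ ∀ k', k' ≠ k → ∀ i', summand j k' = some i' → k ∈ label i'

namespace XorScheme

/-- The summand of user `k` in transmission `j`, when the requested files restricted to the block
are `w`. -/
def term {ι J : Type} (s : XorScheme K ι J) (w : Fin K → ι → Bool) (j : J) (k : Fin K) : Bool :=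
  (s.summand j k).elim false (w k)

/-- Transmission `j`; addition in `Bool` is XOR. -/
def signal {ι J : Type} (s : XorScheme K ι J) (w : Fin K → ι → Bool) (j : J) : Bool :=
  ∑ k, s.term w j k

/-- User `k` recovers its file, as the transmissions and its cache determine it. -/
lemma eq_of_signal_eq {ι J : Type} (s : XorScheme K ι J) {w w' : Fin K → ι → Bool} (k : Fin K)
    (hX : ∀ j, s.signal w j = s.signal w' j)
    (hZ : ∀ k' i, k ∈ s.label i → w k' i = w' k' i) : w k = w' k := by
  funext i
  by_cases hi : k ∈ s.label i
  · exact hZ k i hi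
  obtain ⟨j, hj, hothers⟩ := s.decodable k i hi
  have h := hX j
  have hrest : ∑ k' ∈ univ.erase k, s.term w j k' = ∑ k' ∈ univ.erase k, s.term w' j k' := by
    refine sum_congr rfl fun k' hk' => ?_
    rcases hs : s.summand j k' with _ | i'
    · simp [term, hs]
    · simpa [term, hs] using hZ k' i' (hothers k' (ne_of_mem_erase hk') i' hs)
  rw [signal, signal, ← add_sum_erase _ _ (mem_univ k), ← add_sum_erase _ _ (mem_univ k),
    hrest] at h
  simpa [term, hj] using add_right_cancel h

/-- Juxtaposition of the schemes of two blocks. -/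
def sum {ι J ι' J' : Type} (s : XorScheme K ι J) (s' : XorScheme K ι' J') :
    XorScheme K (ι ⊕ ι') (J ⊕ J') where
  label := Sum.elim s.label s'.label
  summand := Sum.elim (fun j k => (s.summand j k).map Sum.inl)
    (fun j k => (s'.summand j k).map Sum.inr)
  decodable := by
    rintro k (i | i) hi
    · obtain ⟨j, hj, h⟩ := s.decodable k i hi
      refine ⟨Sum.inl j, by simp [hj], fun k' hk' i' hi' => ?_⟩
      obtain ⟨i'', h'', rfl⟩ := Option.map_eq_some_iff.1 hi'
      exact h k' hk' i'' h''
    · obtain ⟨j, hj, h⟩ := s'.decodable k i hi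
      refine ⟨Sum.inr j, by simp [hj], fun k' hk' i' hi' => ?_⟩
      obtain ⟨i'', h'', rfl⟩ := Option.map_eq_some_iff.1 hi'
      exact h k' hk' i'' h''

/-- A single bit that nobody caches, sent to each user separately. -/
def uncached (K : ℕ) : XorScheme K Unit (Fin K) where
  label := fun _ => ∅
  summand := fun j k => if k = j then some () else none
  decodable := fun k _ _ => ⟨k, by simp, fun k' hk' i' hi' => by simp [hk'] at hi'⟩

end XorScheme

/-- Some `XorScheme` has `c S` positions with label `S`, for every `S`, and `L` transmissions. -/
def Deliverable (c : Finset (Fin K) → ℕ) (L : ℕ) : Prop :=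
  ∃ (ι J : Type) (_ : Fintype ι) (_ : Fintype J) (s : XorScheme K ι J),
    (∀ S, (univ.filter fun i => s.label i = S).card = c S) ∧ Fintype.card J = L

namespace Deliverable

lemma zero : Deliverable (K := K) 0 0 :=
  ⟨Empty, Empty, inferInstance, inferInstance,
    ⟨Empty.elim, Empty.elim, fun _ i => i.elim⟩, by simp, by simp⟩

lemma add {c c' : Finset (Fin K) → ℕ} {L L' : ℕ} (h : Deliverable c L) (h' : Deliverable c' L') :
    Deliverable (c + c') (L + L') := by
  obtain ⟨ι, J, _, _, s, hc, hL⟩ := h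
  obtain ⟨ι', J', _, _, s', hc', hL'⟩ := h'
  refine ⟨ι ⊕ ι', J ⊕ J', inferInstance, inferInstance, s.sum s', fun S => ?_, by simp [hL, hL']⟩
  rw [← Fintype.card_subtype, Pi.add_apply, ← hc, ← hc', ← Fintype.card_subtype,
    ← Fintype.card_subtype, ← Fintype.card_sum]
  exact Fintype.card_congr (Equiv.subtypeSum (p := fun i => (s.sum s').label i = S))

lemma nsmul {c : Finset (Fin K) → ℕ} {L : ℕ} (h : Deliverable c L) (n : ℕ) :
    Deliverable (n • c) (n * L) := by
  induction n with
  | zero => simpa using zero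
  | succ n ih => simpa [add_mul, add_smul] using ih.add h

lemma uncached (K n : ℕ) : Deliverable (n • (Pi.single ∅ 1 : Finset (Fin K) → ℕ)) (n * K) := by
  refine nsmul ⟨Unit, Fin K, inferInstance, inferInstance, XorScheme.uncached K, fun S => ?_,
    by simp⟩ n
  by_cases hS : S = ∅
  · subst hS
    simp [XorScheme.uncached]
  · simp [XorScheme.uncached, hS, Ne.symm hS]

end Deliverable

/-- The part of each file that user `k` caches when `c S` of its bits have the label `S`. -/
abbrev cachedBy (c : Finset (Fin K) → ℕ) (k : Fin K) : ℕ := ∑ S with k ∈ S, c S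

lemma cachedBy_uncached (n : ℕ) (k : Fin K) :
    cachedBy (n • (Pi.single ∅ 1 : Finset (Fin K) → ℕ)) k = 0 := by
  refine sum_eq_zero fun S hS => ?_
  have : S ≠ ∅ := ne_empty_of_mem (mem_filter.1 hS).2
  simp [Pi.single_eq_of_ne this]

lemma sum_uncached (n : ℕ) :
    ∑ S, (n • (Pi.single ∅ 1 : Finset (Fin K) → ℕ)) S = n := by
  simp [Pi.single_apply]

/-- The pairs of cache sizes and loads that XOR delivery attains for every file size, up to a
bounded number of additional transmissions. -/
def xorRegion (K : ℕ) : Set ((Fin K → ℝ) × ℝ) :=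
  {p | ∃ C : ℝ, ∀ F : ℕ, ∃ (c : Finset (Fin K) → ℕ) (L : ℕ), Deliverable c L ∧ ∑ S, c S = F ∧
    (∀ k, (cachedBy c k : ℝ) ≤ p.1 k * F) ∧ (L : ℝ) ≤ p.2 * F + C}

/-- Memory sharing: split each file in the given proportion, and leave uncached the at most two bits
lost by rounding. -/
lemma convex_xorRegion : Convex ℝ (xorRegion K) := by
  rintro ⟨m, R⟩ hp ⟨m', R'⟩ hq a b ha hb hab
  obtain ⟨C, hC⟩ := hp
  obtain ⟨C', hC'⟩ := hq
  -- The instance `F = 1` shows that the cache sizes are non-negative.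
  have hm : ∀ k, 0 ≤ m k := fun k => by
    obtain ⟨c, L, -, -, h, -⟩ := hC 1
    simpa using (Nat.cast_nonneg (α := ℝ) _).trans (h k)
  have hm' : ∀ k, 0 ≤ m' k := fun k => by
    obtain ⟨c, L, -, -, h, -⟩ := hC' 1
    simpa using (Nat.cast_nonneg (α := ℝ) _).trans (h k)
  refine ⟨C + C' + |R| + |R'| + 2 * K, fun F => ?_⟩
  have haF : 0 ≤ a * F := by positivity
  have hbF : 0 ≤ b * F := by positivity
  set x := ⌊a * F⌋₊
  set y := ⌊b * F⌋₊
  have hx : (x : ℝ) ≤ a * F := Nat.floor_le haF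
  have hy : (y : ℝ) ≤ b * F := Nat.floor_le hbF
  have hx' : a * F < x + 1 := Nat.lt_floor_add_one _
  have hy' : b * F < y + 1 := Nat.lt_floor_add_one _
  have habF : a * F + b * F = F := by rw [← add_mul, hab, one_mul]
  have hxy : x + y ≤ F := by
    have : (x : ℝ) + y ≤ F := by linarith
    exact_mod_cast this
  obtain ⟨r, hr⟩ := Nat.exists_eq_add_of_le hxy
  have hr' : (F : ℝ) = x + y + r := by exact_mod_cast hr
  obtain ⟨c, L, hD, hsum, hcache, hL⟩ := hC x
  obtain ⟨c', L', hD', hsum', hcache', hL'⟩ := hC' y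
  refine ⟨c + c' + r • Pi.single ∅ 1, L + L' + r * K,
    (hD.add hD').add (Deliverable.uncached K r), ?_, fun k => ?_, ?_⟩
  · simp only [Pi.add_apply, sum_add_distrib]
    rw [sum_uncached, hsum, hsum', hr]
  · have h0 : cachedBy (c + c' + r • Pi.single ∅ 1) k = cachedBy c k + cachedBy c' k := by
      have := cachedBy_uncached (K := K) r k
      simp only [cachedBy, Pi.add_apply, sum_add_distrib] at this ⊢
      rw [this, add_zero]
    rw [h0, Nat.cast_add]
    have h1 := mul_le_mul_of_nonneg_left hx (hm k)
    have h2 := mul_le_mul_of_nonneg_left hy (hm' k)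
    have h3 := hcache k
    have h4 := hcache' k
    simp only [Prod.fst_add, Prod.smul_fst, Pi.add_apply, Pi.smul_apply, smul_eq_mul] at h3 h4 ⊢
    nlinarith
  · have hKr : (r : ℝ) * K ≤ 2 * K :=
      mul_le_mul_of_nonneg_right (by linarith) (Nat.cast_nonneg K)
    have h1 : R * x ≤ R * (a * F) + |R| := by
      have := mul_le_mul_of_nonneg_left (by linarith : a * F - x ≤ 1) (abs_nonneg R)
      have h' := mul_le_mul_of_nonneg_right (neg_abs_le R) (by linarith : 0 ≤ a * F - x)
      linarith
    have h2 : R' * y ≤ R' * (b * F) + |R'| := by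
      have := mul_le_mul_of_nonneg_left (by linarith : b * F - y ≤ 1) (abs_nonneg R')
      have h' := mul_le_mul_of_nonneg_right (neg_abs_le R') (by linarith : 0 ≤ b * F - y)
      linarith
    simp only [Prod.snd_add, Prod.smul_snd, smul_eq_mul] at hL hL' ⊢
    push_cast
    linarith

/-- A scheme for one block of positions, repeated over the whole file. -/
lemma XorScheme.mem_xorRegion {ι J : Type} [Fintype ι] [Nonempty ι] [Fintype J]
    (s : XorScheme K ι J) :
    ((fun k => ((univ.filter fun i => k ∈ s.label i).card : ℝ) / Fintype.card ι,
      (Fintype.card J : ℝ) / Fintype.card ι) : (Fin K → ℝ) × ℝ) ∈ xorRegion K := by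
  classical
  set b := Fintype.card ι with hb
  have hbpos : 0 < b := Fintype.card_pos
  have hbpos' : (0 : ℝ) < b := by exact_mod_cast hbpos
  set c : Finset (Fin K) → ℕ := fun S => (univ.filter fun i => s.label i = S).card with hc
  have hD : Deliverable c (Fintype.card J) :=
    ⟨ι, J, inferInstance, inferInstance, s, fun S => rfl, rfl⟩
  have hsum : ∑ S, c S = b := by
    rw [hb, ← card_univ]
    exact (card_eq_sum_card_fiberwise (fun i _ => mem_univ (s.label i))).symm
  have hcache : ∀ k, cachedBy c k = (univ.filter fun i => k ∈ s.label i).card := by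
    intro k
    rw [card_eq_sum_card_fiberwise (f := s.label)
      (t := univ.filter fun S : Finset (Fin K) => k ∈ S) (fun i hi => by simpa using hi)]
    refine sum_congr rfl fun S hS => ?_
    rw [filter_filter]
    refine congrArg card ?_
    ext i
    simp only [mem_filter, mem_univ, true_and] at hS ⊢
    exact ⟨fun h => ⟨by rw [h]; exact hS, h⟩, fun h => h.2⟩
  refine ⟨b * K, fun F => ⟨(F / b) • c + (F % b) • Pi.single ∅ 1,
    F / b * Fintype.card J + F % b * K,
    (hD.nsmul _).add (Deliverable.uncached K _), ?_, fun k => ?_, ?_⟩⟩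
  · simp only [Pi.add_apply, sum_add_distrib]
    rw [sum_uncached]
    simp only [Pi.smul_apply, smul_eq_mul, ← mul_sum, hsum]
    exact Nat.div_add_mod' F b
  · have h0 : cachedBy ((F / b) • c + (F % b) • Pi.single ∅ 1) k = F / b * cachedBy c k := by
      have := cachedBy_uncached (K := K) (F % b) k
      simp only [cachedBy, Pi.add_apply, sum_add_distrib] at this ⊢
      rw [this, add_zero, mul_sum]
      rfl
    rw [h0, hcache, Nat.cast_mul, div_mul_eq_mul_div, mul_comm, mul_div_assoc]
    exact mul_le_mul_of_nonneg_left Nat.cast_div_le (Nat.cast_nonneg _)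
  · have h1 : ((F / b : ℕ) : ℝ) * Fintype.card J ≤ F / b * Fintype.card J :=
      mul_le_mul_of_nonneg_right Nat.cast_div_le (Nat.cast_nonneg _)
    have h2 : ((F % b : ℕ) : ℝ) * K ≤ b * K :=
      mul_le_mul_of_nonneg_right (by exact_mod_cast (Nat.mod_lt F hbpos).le) (Nat.cast_nonneg _)
    push_cast
    calc ((F / b : ℕ) : ℝ) * Fintype.card J + ((F % b : ℕ) : ℝ) * K
        ≤ F / b * Fintype.card J + b * K := add_le_add h1 h2
      _ = Fintype.card J / b * F + b * K := by ring

/-- XOR delivery as a `DeliveryScheme` without error, all of whose bits are sent in the signal for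
the group of all users. -/
lemma exists_deliveryScheme [NeZero K] {m : Fin K → ℝ} {R : ℝ} (hR : 0 ≤ R) (hN : 0 < N)
    (hF : 0 < F) {c : Finset (Fin K) → ℕ} {L : ℕ} (hD : Deliverable c L) (hsum : ∑ S, c S = F)
    (hcache : ∀ k, (cachedBy c k : ℝ) ≤ m k * F) (hL : (L : ℝ) ≤ R * F) :
    ∃ (P : UncodedPlacement N F m) (D : DeliveryScheme P),
      D.worstCaseLoad = R ∧ ∀ (d : Demand K N) (k : Fin K), D.errorProb d k = 0 := by
  classical
  obtain ⟨ι, J, _, _, s, hc, rfl⟩ := hD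
  have hF' : (0 : ℝ) < F := by exact_mod_cast hF
  have hι : Fintype.card ι = F := by
    rw [← hsum, ← card_univ, card_eq_sum_card_fiberwise (fun i _ => mem_univ (s.label i))]
    exact sum_congr rfl fun S _ => hc S
  let e : Fin F ≃ ι := (Fintype.equivFinOfCardEq hι).symm
  let eJ := Fintype.equivFin J
  have hsum' : ∑ S, (c S : ℝ) = F := by exact_mod_cast hsum
  let P : UncodedPlacement N F m :=
    { alloc := fun S => c S / F
      alloc_mem := by
        refine ⟨fun S => ⟨by positivity, ?_⟩, ?_, fun k => ?_⟩
        · rw [div_le_one hF', ← hsum']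
          exact single_le_sum (f := fun S => (c S : ℝ)) (fun _ _ => Nat.cast_nonneg _)
            (mem_univ S)
        · rw [← sum_div, hsum', div_self hF'.ne']
        · rw [← sum_div, div_le_iff₀ hF']
          exact_mod_cast hcache k
      storedAt := fun _ i => s.label (e i)
      card_subfile := fun _ S => by
        rw [div_mul_cancel₀ _ hF'.ne', ← hc S]
        norm_cast
        rw [← Fintype.card_subtype, ← Fintype.card_subtype]
        exact Fintype.card_congr (e.subtypeEquiv fun i => Iff.rfl) }
  let G : UserGroup K := ⟨univ, univ_nonempty⟩
  let v : UserGroup K → ℝ := fun T => if T = G then R else 0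
  let enc : ∀ T : UserGroup K, (Fin K → File F) → (Fin ⌊v T * F⌋₊ → Bool) := fun T w x =>
    if h : x.1 < Fintype.card J then s.signal (fun k i => w k (e.symm i)) (eJ.symm ⟨x.1, h⟩)
    else false
  let obs : Demand K N → (k : Fin K) → Library N F →
      (∀ T : UserGroup K, Fin ⌊v T * F⌋₊ → Bool) × (P.CachedBit k → Bool) := fun d k W =>
    (fun T => enc T (fun j => W (d j)), P.cacheContent k W)
  -- What user `k` observes determines its requested file.
  have hobs : ∀ d k, Function.FactorsThrough (fun W : Library N F => W (d k)) (obs d k) := by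
    intro d k W W' h
    obtain ⟨hX, hZ⟩ := Prod.mk.inj h
    have hlen : Fintype.card J ≤ ⌊v G * F⌋₊ := Nat.le_floor (by simpa [v] using hL)
    have hsig : ∀ j, s.signal (fun k i => W (d k) (e.symm i)) j =
        s.signal (fun k i => W' (d k) (e.symm i)) j := by
      intro j
      have := congrFun (congrFun hX G) ⟨(eJ j).1, (eJ j).2.trans_le hlen⟩
      simpa [enc] using this
    have := s.eq_of_signal_eq k hsig fun k' i hi => by
      have hstored : k ∈ P.storedAt (d k') (e.symm i) := by simpa [P] using hi
      exact congrFun hZ ⟨(d k', e.symm i), hstored⟩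
    funext x
    simpa using congrFun this (e x)
  let D : DeliveryScheme P :=
    { v := fun _ => v
      v_nonneg := fun _ T => by
        simp only [v]
        split_ifs <;> simp [hR]
      encode := fun _ => enc
      decode := fun d k X Z =>
        Function.extend (obs d k) (fun W : Library N F => W (d k)) (fun _ _ => false) (X, Z) }
  refine ⟨P, D, ?_, fun d k => ?_⟩
  · have : Nonempty (Fin N) := ⟨⟨0, hN⟩⟩
    have hload : ∀ d, D.load d = R := fun d => by simp [DeliveryScheme.load, D, v]
    simp [DeliveryScheme.worstCaseLoad, hload]
  · have hrec : ∀ W, D.reconstruct d k W = W (d k) := fun W =>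
      (hobs d k).extend_apply (fun _ _ => false) W
    simp [DeliveryScheme.errorProb, hrec]

/-- Only loads strictly above `R` are obtained, as the bounded number of additional transmissions
has to be absorbed for large files. -/
lemma mem_achievableLoads_of_mem_xorRegion [NeZero K] (hN : 0 < N) {m : Fin K → ℝ} {R R' : ℝ}
    (h : (m, R) ∈ xorRegion K) (hR : 0 ≤ R) (hRR' : R < R') : R' ∈ achievableLoads N m := by
  obtain ⟨C, hC⟩ := h
  intro ε hε
  obtain ⟨n, hn⟩ := exists_nat_gt (C / (R' - R))
  refine ⟨n + 1, fun F hF => ?_⟩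
  obtain ⟨c, L, hD, hsum, hcache, hL⟩ := hC F
  have hnF : (n : ℝ) ≤ F := by exact_mod_cast (Nat.le_succ n).trans hF
  have hCF : C ≤ (R' - R) * F := by
    rw [div_lt_iff₀ (by linarith)] at hn
    nlinarith
  obtain ⟨P, D, hload, herr⟩ := exists_deliveryScheme (N := N) (R := R') (by linarith) hN
    (by omega) hD hsum hcache (by simp only at hL; linarith)
  exact ⟨P, D, hload, fun d k => by rw [herr]; exact hε.le⟩

/-! ### Three users: lower bounds -/

lemma sum_finset_fin_three (g : Finset (Fin 3) → ℝ) :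
    ∑ S, g S = g ∅ + g {0} + g {1} + g {2} + g {0, 1} + g {0, 2} + g {1, 2} + g {0, 1, 2} := by
  have : (univ : Finset (Finset (Fin 3))) =
      {∅, {0}, {1}, {2}, {0, 1}, {0, 2}, {1, 2}, {0, 1, 2}} := by decide
  rw [this]
  iterate 7 rw [sum_insert (by decide)]
  rw [sum_singleton]
  ring

/-- The acyclic bounds for the orders `012`, `021` and `120` of the users imply the four bounds: the
first alone gives all of them but the one with slope `1 / 3`, which is the average of the three. -/
lemma le_of_mem_achievableLoads (hN : 3 ≤ N) {m₁ m₂ m₃ R : ℝ}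
    (hR : R ∈ achievableLoads N ![m₁, m₂, m₃]) :
    max (3 - (3 * m₁ + 2 * m₂ + m₃))
      (max (5 / 3 - (3 * m₁ + 2 * m₂ + m₃) / 3) (max (2 - 2 * m₁ - m₂) (1 - m₁))) ≤ R := by
  refine le_of_forall_pos_le_add fun δ hδ => ?_
  obtain ⟨a, ⟨hpos, hsum, hcache⟩, ha⟩ := exists_alloc_le_of_mem_achievableLoads hN hR hδ
  have hnn : ∀ S, 0 ≤ a S := fun S => (hpos S).1
  have c0 := hcache 0
  have c1 := hcache 1
  have c2 := hcache 2
  -- The orders `012`, `021` and `120`.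
  have p1 := ha 1
  have p2 := ha (Equiv.swap 1 2)
  have p3 := ha (finRotate 3)
  simp only [sum_filter, Fin.sum_univ_three, sum_finset_fin_three] at hsum c0 c1 c2 p1 p2 p3
  simp +decide only [if_true, if_false] at c0 c1 c2 p1 p2 p3
  simp only [Matrix.cons_val] at c0 c1 c2
  have n0 := hnn ∅
  have n1 := hnn {0}
  have n2 := hnn {1}
  have n3 := hnn {2}
  have n4 := hnn {0, 1}
  have n5 := hnn {0, 2}
  have n6 := hnn {1, 2}
  have n7 := hnn {0, 1, 2}
  refine max_le ?_ (max_le ?_ (max_le ?_ ?_)) <;> linarith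

/-! ### Three users: corner schemes -/

/-- The region contains the point that a block scheme attains, given by its numbers of cached
positions, of transmissions and of positions. -/
lemma XorScheme.mem_xorRegion_three {n L : ℕ} [NeZero n] (s : XorScheme 3 (Fin n) (Fin L))
    {x y z r : ℝ} (hx : ((univ.filter fun i => 0 ∈ s.label i).card : ℝ) / n = x)
    (hy : ((univ.filter fun i => 1 ∈ s.label i).card : ℝ) / n = y)
    (hz : ((univ.filter fun i => 2 ∈ s.label i).card : ℝ) / n = z) (hr : (L : ℝ) / n = r) :
    (![x, y, z], r) ∈ xorRegion 3 := by
  convert s.mem_xorRegion using 1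
  refine Prod.ext ?_ (by simp [← hr])
  funext k
  fin_cases k
  · simpa using hx.symm
  · simpa using hy.symm
  · simpa using hz.symm

lemma corner_no_cache : (![0, 0, 0], 3) ∈ xorRegion 3 :=
  XorScheme.mem_xorRegion_three (n := 1) (L := 3)
    { label := ![∅]
      summand := ![![some 0, none, none],
        ![none, some 0, none],
        ![none, none, some 0]]
      decodable := by decide }
    (by rw [show (univ.filter _).card = 0 by decide]; norm_num)
    (by rw [show (univ.filter _).card = 0 by decide]; norm_num)
    (by rw [show (univ.filter _).card = 0 by decide]; norm_num)
    (by norm_num)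

lemma corner_third_full : (![0, 0, 1], 2) ∈ xorRegion 3 :=
  XorScheme.mem_xorRegion_three (n := 1) (L := 2)
    { label := ![{2}]
      summand := ![![some 0, none, none],
        ![none, some 0, none]]
      decodable := by decide }
    (by rw [show (univ.filter _).card = 0 by decide]; norm_num)
    (by rw [show (univ.filter _).card = 0 by decide]; norm_num)
    (by rw [show (univ.filter _).card = 1 by decide]; norm_num)
    (by norm_num)

lemma corner_two_halves : (![0, 1 / 2, 1 / 2], 3 / 2) ∈ xorRegion 3 :=
  XorScheme.mem_xorRegion_three (n := 2) (L := 3)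
    { label := ![{1}, {2}]
      summand := ![![some 0, none, none],
        ![some 1, none, none],
        ![none, some 1, some 0]]
      decodable := by decide }
    (by rw [show (univ.filter _).card = 0 by decide]; norm_num)
    (by rw [show (univ.filter _).card = 1 by decide]; norm_num)
    (by rw [show (univ.filter _).card = 1 by decide]; norm_num)
    (by norm_num)

lemma corner_thirds : (![1 / 3, 1 / 3, 1 / 3], 1) ∈ xorRegion 3 :=
  XorScheme.mem_xorRegion_three (n := 3) (L := 3)
    { label := ![{0}, {1}, {2}]
      summand := ![![some 1, some 0, none],
        ![some 2, none, some 0],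
        ![none, some 2, some 1]]
      decodable := by decide }
    (by rw [show (univ.filter _).card = 1 by decide]; norm_num)
    (by rw [show (univ.filter _).card = 1 by decide]; norm_num)
    (by rw [show (univ.filter _).card = 1 by decide]; norm_num)
    (by norm_num)

lemma corner_all_full : (![1, 1, 1], 0) ∈ xorRegion 3 :=
  XorScheme.mem_xorRegion_three (n := 1) (L := 0)
    { label := ![{0, 1, 2}]
      summand := Fin.elim0
      decodable := by decide }
    (by rw [show (univ.filter _).card = 1 by decide]; norm_num)
    (by rw [show (univ.filter _).card = 1 by decide]; norm_num)
    (by rw [show (univ.filter _).card = 1 by decide]; norm_num)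
    (by norm_num)

lemma corner_two_full : (![0, 1, 1], 1) ∈ xorRegion 3 :=
  XorScheme.mem_xorRegion_three (n := 1) (L := 1)
    { label := ![{1, 2}]
      summand := ![![some 0, none, none]]
      decodable := by decide }
    (by rw [show (univ.filter _).card = 0 by decide]; norm_num)
    (by rw [show (univ.filter _).card = 1 by decide]; norm_num)
    (by rw [show (univ.filter _).card = 1 by decide]; norm_num)
    (by norm_num)

/-- User `2` caches everything; the other two exchange their halves by one XOR. -/
lemma corner_halves : (![1 / 2, 1 / 2, 1], 1 / 2) ∈ xorRegion 3 :=
  XorScheme.mem_xorRegion_three (n := 2) (L := 1)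
    { label := ![{0, 2}, {1, 2}]
      summand := ![![some 1, some 0, none]]
      decodable := by decide }
    (by rw [show (univ.filter _).card = 1 by decide]; norm_num)
    (by rw [show (univ.filter _).card = 1 by decide]; norm_num)
    (by rw [show (univ.filter _).card = 2 by decide]; norm_num)
    (by norm_num)

lemma corner_two_thirds : (![2 / 3, 2 / 3, 2 / 3], 1 / 3) ∈ xorRegion 3 :=
  XorScheme.mem_xorRegion_three (n := 3) (L := 1)
    { label := ![{1, 2}, {0, 2}, {0, 1}]
      summand := ![![some 0, some 1, some 2]]
      decodable := by decide }
    (by rw [show (univ.filter _).card = 2 by decide]; norm_num)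
    (by rw [show (univ.filter _).card = 2 by decide]; norm_num)
    (by rw [show (univ.filter _).card = 2 by decide]; norm_num)
    (by norm_num)

/-- User `0` caches one third, and users `1` and `2` both cache the other two. Each of the two bits
that user `0` misses is paired with the bit that one of the other users misses. -/
lemma corner_mixed_thirds : (![1 / 3, 2 / 3, 2 / 3], 2 / 3) ∈ xorRegion 3 :=
  XorScheme.mem_xorRegion_three (n := 3) (L := 2)
    { label := ![{0}, {1, 2}, {1, 2}]
      summand := ![![some 1, some 0, none],
        ![some 2, none, some 0]]
      decodable := by decide }
    (by rw [show (univ.filter _).card = 1 by decide]; norm_num)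
    (by rw [show (univ.filter _).card = 2 by decide]; norm_num)
    (by rw [show (univ.filter _).card = 2 by decide]; norm_num)
    (by norm_num)

/-! ### Three users: memory sharing between the corners -/

/-- Memory sharing between four corner schemes. -/
lemma mem_xorRegion_of_weights {p q s t : (Fin 3 → ℝ) × ℝ} (hp : p ∈ xorRegion 3)
    (hq : q ∈ xorRegion 3) (hs : s ∈ xorRegion 3) (ht : t ∈ xorRegion 3) {a b c e : ℝ}
    (ha : 0 ≤ a) (hb : 0 ≤ b) (hc : 0 ≤ c) (he : 0 ≤ e) (habce : a + b + c + e = 1)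
    {m₁ m₂ m₃ R : ℝ}
    (h0 : a * p.1 0 + b * q.1 0 + c * s.1 0 + e * t.1 0 = m₁)
    (h1 : a * p.1 1 + b * q.1 1 + c * s.1 1 + e * t.1 1 = m₂)
    (h2 : a * p.1 2 + b * q.1 2 + c * s.1 2 + e * t.1 2 = m₃)
    (hR : a * p.2 + b * q.2 + c * s.2 + e * t.2 = R) : (![m₁, m₂, m₃], R) ∈ xorRegion 3 := by
  have := convex_xorRegion.sum_mem (t := univ) (w := ![a, b, c, e]) (z := ![p, q, s, t])
    (fun i _ => by fin_cases i <;> simpa) (by simpa [Fin.sum_univ_four] using habce)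
    (fun i _ => by fin_cases i <;> simpa)
  convert this using 1
  refine Prod.ext ?_ ?_
  · funext k
    fin_cases k <;> simp [Fin.sum_univ_four, ← h0, ← h1, ← h2]
  · simp [Fin.sum_univ_four, ← hR]

/-- The region is the simplex of the four corners used; the weights are the barycentric
coordinates. -/
lemma mem_xorRegion_of_sum_le_one {m₁ m₂ m₃ : ℝ} (h₁ : 0 ≤ m₁) (h₁₂ : m₁ ≤ m₂) (h₂₃ : m₂ ≤ m₃)
    (h : m₁ + m₂ + m₃ ≤ 1) :
    (![m₁, m₂, m₃], 3 - (3 * m₁ + 2 * m₂ + m₃)) ∈ xorRegion 3 :=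
  mem_xorRegion_of_weights corner_no_cache corner_third_full corner_two_halves corner_thirds
    (a := 1 - m₁ - m₂ - m₃) (b := m₃ - m₂) (c := 2 * (m₂ - m₁)) (e := 3 * m₁)
    (by linarith) (by linarith) (by linarith) (by linarith) (by ring)
    (by simp; ring) (by simp; ring) (by simp; ring) (by simp; ring)

/-- The region, where the load falls with slope `1 / 3` in `m₃`, is the simplex of the four corners
used; the weights are the barycentric coordinates. -/
lemma mem_xorRegion_of_third_slope {m₁ m₂ m₃ : ℝ} (h₁₂ : m₁ ≤ m₂) (h₂₃ : m₂ ≤ m₃)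
    (h : m₃ ≤ m₂ + 3 * m₁ - 1) (h' : 2 * m₂ + m₃ ≤ 2) :
    (![m₁, m₂, m₃], 5 / 3 - (3 * m₁ + 2 * m₂ + m₃) / 3) ∈ xorRegion 3 :=
  mem_xorRegion_of_weights corner_thirds corner_halves corner_two_thirds corner_mixed_thirds
    (a := 2 - 2 * m₂ - m₃) (b := 2 * (m₃ - m₂)) (c := m₂ + 3 * m₁ - 1 - m₃) (e := 3 * (m₂ - m₁))
    (by linarith) (by linarith) (by linarith) (by linarith) (by ring)
    (by simp; ring) (by simp; ring) (by simp; ring) (by simp; ring)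

/-- The region has the corners `(0, 0, 1)`, `(0, 1/2, 1/2)`, `(1/3, 1/3, 1/3)`, `(0, 1, 1)`,
`(1/2, 1/2, 1)` and `(1/3, 2/3, 2/3)`. It is a union of three simplices with the common vertex
`(0, 1, 1)`; the weights are the barycentric coordinates. -/
lemma mem_xorRegion_of_add_le_one {m₁ m₂ m₃ : ℝ} (h₁ : 0 ≤ m₁) (h₁₂ : m₁ ≤ m₂) (h₂₃ : m₂ ≤ m₃)
    (h₃ : m₃ ≤ 1) (hsum : 1 ≤ m₁ + m₂ + m₃) (h : m₂ + 3 * m₁ - 1 ≤ m₃) (h' : m₁ + m₂ ≤ 1) :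
    (![m₁, m₂, m₃], 2 - 2 * m₁ - m₂) ∈ xorRegion 3 := by
  rcases le_total (2 * m₁ + 2 * m₂ - m₃) 1 with h4 | h4
  · rcases le_total (2 * m₁ + m₃) 1 with h5 | h5
    · exact mem_xorRegion_of_weights corner_two_full corner_third_full corner_two_halves
        corner_thirds
        (a := m₁ + m₂ + m₃ - 1) (b := m₃ - m₂) (c := 2 * (1 - 2 * m₁ - m₃)) (e := 3 * m₁)
        (by linarith) (by linarith) (by linarith) (by linarith) (by ring)
        (by simp; ring) (by simp; ring) (by simp; ring) (by simp; ring)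
    · exact mem_xorRegion_of_weights corner_two_full corner_third_full corner_thirds corner_halves
        (a := m₂ - m₁) (b := (1 - 2 * m₁ - 2 * m₂ + m₃) / 2) (c := 3 / 2 * (1 - m₃))
        (e := 2 * m₁ + m₃ - 1)
        (by linarith) (by linarith) (by linarith) (by linarith) (by ring)
        (by simp; ring) (by simp; ring) (by simp; ring) (by simp; ring)
  · exact mem_xorRegion_of_weights corner_two_full corner_thirds corner_halves corner_mixed_thirds
      (a := m₃ - m₂ - 3 * m₁ + 1) (b := 3 * (1 - m₁ - m₂)) (c := 2 * (m₃ - m₂))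
      (e := 3 * (2 * m₁ + 2 * m₂ - m₃ - 1))
      (by linarith) (by linarith) (by linarith) (by linarith) (by ring)
      (by simp; ring) (by simp; ring) (by simp; ring) (by simp; ring)

/-- The region has the corners `(1, 1, 1)`, `(0, 1, 1)`, `(1/2, 1/2, 1)`, `(2/3, 2/3, 2/3)` and
`(1/3, 2/3, 2/3)`. It is cut into two simplices by the plane through the first, third and last. -/
lemma mem_xorRegion_of_one_le_add {m₁ m₂ m₃ : ℝ} (h₁₂ : m₁ ≤ m₂) (h₂₃ : m₂ ≤ m₃) (h₃ : m₃ ≤ 1)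
    (h : 1 ≤ m₁ + m₂) (h' : 2 ≤ 2 * m₂ + m₃) :
    (![m₁, m₂, m₃], 1 - m₁) ∈ xorRegion 3 := by
  rcases le_total (m₂ + m₃ - m₁) 1 with h4 | h4
  · exact mem_xorRegion_of_weights corner_all_full corner_halves corner_two_thirds
      corner_mixed_thirds
      (a := 2 * m₂ + m₃ - 2) (b := 2 * (m₃ - m₂)) (c := 3 * (m₁ - m₂ - m₃ + 1)) (e := 3 * (m₂ - m₁))
      (by linarith) (by linarith) (by linarith) (by linarith) (by ring)
      (by simp; ring) (by simp; ring) (by simp; ring) (by simp; ring)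
  · exact mem_xorRegion_of_weights corner_all_full corner_two_full corner_halves corner_mixed_thirds
      (a := m₁ + m₂ - 1) (b := m₂ + m₃ - m₁ - 1) (c := 2 * (m₃ - m₂)) (e := 3 * (1 - m₃))
      (by linarith) (by linarith) (by linarith) (by linarith) (by ring)
      (by simp; ring) (by simp; ring) (by simp; ring) (by simp; ring)

/-- XOR delivery attains the maximum of the four lower bounds: on each region of linearity it
attains one of them. -/
lemma max_mem_xorRegion {m₁ m₂ m₃ : ℝ} (h₁ : 0 ≤ m₁) (h₁₂ : m₁ ≤ m₂) (h₂₃ : m₂ ≤ m₃)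
    (h₃ : m₃ ≤ 1) : (![m₁, m₂, m₃], max (3 - (3 * m₁ + 2 * m₂ + m₃))
      (max (5 / 3 - (3 * m₁ + 2 * m₂ + m₃) / 3) (max (2 - 2 * m₁ - m₂) (1 - m₁)))) ∈
      xorRegion 3 := by
  set M := max (3 - (3 * m₁ + 2 * m₂ + m₃))
      (max (5 / 3 - (3 * m₁ + 2 * m₂ + m₃) / 3) (max (2 - 2 * m₁ - m₂) (1 - m₁))) with hM
  have mono : ∀ R, R ≤ M → (![m₁, m₂, m₃], R) ∈ xorRegion 3 →
      (![m₁, m₂, m₃], M) ∈ xorRegion 3 := by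
    rintro R hRM ⟨C, hC⟩
    refine ⟨C, fun F => ?_⟩
    obtain ⟨c, L, hD, hsum, hcache, hL⟩ := hC F
    exact ⟨c, L, hD, hsum, hcache,
      hL.trans (by simpa using mul_le_mul_of_nonneg_right hRM (Nat.cast_nonneg F))⟩
  rcases le_total (m₁ + m₂ + m₃) 1 with hs | hs
  · exact mono _ (by simp [hM]) (mem_xorRegion_of_sum_le_one h₁ h₁₂ h₂₃ hs)
  by_cases hC : 1 ≤ m₁ + m₂ ∧ 2 ≤ 2 * m₂ + m₃
  · exact mono _ (by simp [hM]) (mem_xorRegion_of_one_le_add h₁₂ h₂₃ h₃ hC.1 hC.2)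
  rcases le_total m₃ (m₂ + 3 * m₁ - 1) with hD | hD
  · refine mono _ (by simp [hM]) (mem_xorRegion_of_third_slope h₁₂ h₂₃ hD ?_)
    by_contra! h
    exact hC ⟨by linarith, h.le⟩
  · refine mono _ (by simp [hM]) (mem_xorRegion_of_add_le_one h₁ h₁₂ h₂₃ h₃ hs hD ?_)
    by_contra! h
    exact hC ⟨h.le, by linarith⟩

end CodedCaching

theorem mainTheorem2 (N : ℕ) (hN : 3 ≤ N) (m₁ m₂ m₃ : ℝ)
    (h₁ : 0 ≤ m₁) (h₁₂ : m₁ ≤ m₂) (h₂₃ : m₂ ≤ m₃) (h₃ : m₃ ≤ 1) :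
    -- the infimum that defines the minimum load is a genuine one
    (CodedCaching.achievableLoads N ![m₁, m₂, m₃]).Nonempty ∧
    BddBelow (CodedCaching.achievableLoads N ![m₁, m₂, m₃]) ∧
    -- the trade-off
    CodedCaching.minUncodedLoad N ![m₁, m₂, m₃] =
      max (3 - (3 * m₁ + 2 * m₂ + m₃))
        (max (5 / 3 - (3 * m₁ + 2 * m₂ + m₃) / 3) (max (2 - 2 * m₁ - m₂) (1 - m₁))) ∧
    -- the regions
    (m₁ + m₂ + m₃ ≤ 1 →
      CodedCaching.minUncodedLoad N ![m₁, m₂, m₃] = 3 - (3 * m₁ + 2 * m₂ + m₃)) ∧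
    (1 ≤ m₁ + m₂ + m₃ → m₁ + m₂ + m₃ ≤ 2 →
      (m₃ < m₂ + 3 * m₁ - 1 → 2 * m₂ + m₃ < 2 →
        CodedCaching.minUncodedLoad N ![m₁, m₂, m₃] = 5 / 3 - (3 * m₁ + 2 * m₂ + m₃) / 3) ∧
      (m₂ + 3 * m₁ - 1 ≤ m₃ → m₁ + m₂ < 1 →
        CodedCaching.minUncodedLoad N ![m₁, m₂, m₃] = 2 - 2 * m₁ - m₂) ∧
      (2 ≤ 2 * m₂ + m₃ → 1 ≤ m₁ + m₂ →
        CodedCaching.minUncodedLoad N ![m₁, m₂, m₃] = 1 - m₁)) ∧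
    (2 ≤ m₁ + m₂ + m₃ →
      CodedCaching.minUncodedLoad N ![m₁, m₂, m₃] = 1 - m₁) := by
  have hlb : ∀ R ∈ CodedCaching.achievableLoads N ![m₁, m₂, m₃], _ ≤ R :=
    fun R hR => CodedCaching.le_of_mem_achievableLoads hN hR
  set M := max (3 - (3 * m₁ + 2 * m₂ + m₃))
      (max (5 / 3 - (3 * m₁ + 2 * m₂ + m₃) / 3) (max (2 - 2 * m₁ - m₂) (1 - m₁))) with hM
  have hM0 : 0 ≤ M := (by linarith : 0 ≤ 1 - m₁).trans (by simp [hM])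
  have hach : ∀ R, M < R → R ∈ CodedCaching.achievableLoads N ![m₁, m₂, m₃] := fun R hR =>
    CodedCaching.mem_achievableLoads_of_mem_xorRegion (by omega)
      (CodedCaching.max_mem_xorRegion h₁ h₁₂ h₂₃ h₃) hM0 hR
  have hne : (CodedCaching.achievableLoads N ![m₁, m₂, m₃]).Nonempty := ⟨M + 1, hach _ (by simp)⟩
  have hbdd : BddBelow (CodedCaching.achievableLoads N ![m₁, m₂, m₃]) := ⟨M, hlb⟩
  have hinf : CodedCaching.minUncodedLoad N ![m₁, m₂, m₃] = M :=
    le_antisymm (le_of_forall_gt_imp_ge_of_dense fun R hR => csInf_le hbdd (hach R hR))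
      (le_csInf hne hlb)
  have hregion : ∀ x, x ≤ M → 3 - (3 * m₁ + 2 * m₂ + m₃) ≤ x →
      5 / 3 - (3 * m₁ + 2 * m₂ + m₃) / 3 ≤ x → 2 - 2 * m₁ - m₂ ≤ x → 1 - m₁ ≤ x → M = x :=
    fun x hx ha hb hc hd => le_antisymm (max_le ha (max_le hb (max_le hc hd))) hx
  refine ⟨hne, hbdd, hinf, ?_⟩
  rw [hinf]
  -- In each case the region makes one of the four terms dominate the other three.
  refine ⟨fun h => ?_, fun h h' => ⟨fun h4 h5 => ?_, fun h4 h5 => ?_, fun h4 h5 => ?_⟩, fun h => ?_⟩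
  all_goals
    refine hregion _ (by simp [hM]) ?_ ?_ ?_ ?_ <;> linarith
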